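/- Let $d,k\ge 0$ be integers, $E\subset\mathbb{Z}^k$, and let $\mathcal{Z}(t)=(A(t),M(t))$, $t=0,1,2,\dots$, be a Markov process on $\mathbb{Z}^d\times E$, with transition probabilities $p(z,z')\ge 0$ that may be strictly substochastic ($\sum_{z'}p(z,z')\le 1$ for every $z$). Suppose that it is Markov-additive, that is, $p\bigl((x,y),(x',y')\bigr)=p\bigl((0,y),(x'-x,y')\bigr)$ for all $x,x'\in\mathbb{Z}^d$ and $y,y'\in E$. Let $p^{(n)}(z,z')$ be the $n$-step transition probabilities, let $\mathcal{G}(z,z')=\sum_{n\ge 0}p^{(n)}(z,z')$ be Green's function, and let $|\cdot|$ and $a\cdot z$ denote the Euclidean norm and the scalar product on $\mathbb{R}^{d+k}\supset\mathbb{Z}^d\times E$. Assume that the process is transient ($\mathcal{G}(z,z)<\infty$ for all $z$) and satisfies (A1) it is irreducible: for all $z,z'\in\mathbb{Z}^d\times E$ there is $n\ge 0$ with $p^{(n)}(z,z')>0$; (A2) the function $$\hat\varphi(a)=\sup_{z\in\mathbb{Z}^d\times E}\mathbb{E}_z\bigl(e^{a\cdot(\mathcal{Z}(1)-z)}\bigr)=\sup_{z\in\mathbb{Z}^d\times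 E}\ \sum_{z'\in\mathbb{Z}^d\times E}p(z,z')\,e^{a\cdot(z'-z)},\qquad a\in\mathbb{R}^{d+k},$$ is finite in a neighborhood of zero. Let $(z_n)$ be a sequence of points of $\mathbb{Z}^d\times E$ with $|z_n|\to\infty$ such that, for some $z_0\in\mathbb{Z}^d\times E$, $$\liminf_{n\to\infty}\frac{1}{|z_n|}\log\mathcal{G}(z_0,z_n)\ \ge\ 0 .$$ Then $$\lim_{n\to\infty}\frac{\mathcal{G}(z+w,z_n)}{\mathcal{G}(z+w',z_n)}=1$$ for all $z\in\mathbb{Z}^d\times E$ and all $w,w'\in\mathbb{Z}^d\times\{0\}$ for which there is an integer $m>0$ with $$\inf_{u\in\mathbb{Z}^d\times E}\ \min\bigl\{p^{(m)}(u,u+w),\,p^{(m)}(u,u+w')\bigr\}>0 .$$ -/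

import Mathlib

open Filter Topology
open scoped ENNReal

/-- The state space `ℤ^d × E`, where `E ⊆ ℤ^k`. -/
abbrev MAState (d k : ℕ) (E : Set (Fin k → ℤ)) : Type := (Fin d → ℤ) × E

namespace MAState

variable {d k : ℕ} {E : Set (Fin k → ℤ)}

/-- The point of `ℤ^d × E ⊆ ℤ^(d+k)` as a vector of the Euclidean space `ℝ^(d+k)`. -/
noncomputable def toEuclidean (z : MAState d k E) : EuclideanSpace ℝ (Fin d ⊕ Fin k) :=
  WithLp.toLp 2 (Sum.elim (fun i => (z.1 i : ℝ)) (fun j => (z.2.1 j : ℝ)))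

/-- `z + w` for `w ∈ ℤ^d × {0}`; such a `w` is given by its `ℤ^d`-component. -/
def shift (z : MAState d k E) (w : Fin d → ℤ) : MAState d k E := (z.1 + w, z.2)

end MAState

/-- A discrete-time Markov-additive process on `ℤ^d × E`, given by its (possibly strictly
substochastic) transition probabilities, which are invariant under shifts of the additive part. -/
structure MarkovAdditiveProcess (d k : ℕ) (E : Set (Fin k → ℤ)) where
  /-- `prob z z'` is the probability to go from `z` to `z'` in one step. -/
  prob : MAState d k E → MAState d k E → ℝ≥0∞
  sum_prob_le_one : ∀ z, ∑' z', prob z z' ≤ 1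
  prob_additive : ∀ (x x' : Fin d → ℤ) (y y' : E),
    prob (x, y) (x', y') = prob (0, y) (x' - x, y')

namespace MarkovAdditiveProcess

variable {d k : ℕ} {E : Set (Fin k → ℤ)} (Z : MarkovAdditiveProcess d k E)

/-- The `n`-step transition probabilities `p^(n)(z, z')`. -/
noncomputable def stepProb : ℕ → MAState d k E → MAState d k E → ℝ≥0∞
  | 0, z, z' => if z = z' then 1 else 0
  | n + 1, z, z' => ∑' u, Z.prob z u * stepProb n u z'

/-- Green's function `G(z, z') = ∑_n p^(n)(z, z')`. -/
noncomputable def green (z z' : MAState d k E) : ℝ≥0∞ := ∑' n, Z.stepProb n z z'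

/-- Every state is reached from every state with positive probability. -/
def Irreducible : Prop := ∀ z z', ∃ n, 0 < Z.stepProb n z z'

/-- Every state is transient: the expected number of visits to it from itself is finite. -/
def Transient : Prop := ∀ z, Z.green z z < ∞

/-- `φ̂(a) = sup_z 𝔼_z (exp (a · (Z(1) - z)))`, the expectation being over the event that the
process is not killed in its first step. -/
noncomputable def jumpTransform (a : EuclideanSpace ℝ (Fin d ⊕ Fin k)) : ℝ≥0∞ :=
  ⨆ z : MAState d k E, ∑' z' : MAState d k E,
    Z.prob z z' * ENNReal.ofReal (Real.exp (inner ℝ a (z'.toEuclidean - z.toEuclidean)))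

/-- The function `φ̂` is finite in a neighbourhood of zero. -/
def UniformExpMoments : Prop := ∀ᶠ a in 𝓝 0, Z.jumpTransform a < ∞

end MarkovAdditiveProcess

/-! Let `A`, `B` be the shifts by `w`, `w'`, and `P` the transition operator. By hypothesis `P ^ m =
δ • (A + B) + R` with `δ > 0` and `R` nonnegative, and additivity makes `A`, `B`, `R` commute where
needed. Green's function is `∑ n, (P ^ m) ^ n` applied to a fixed function, so `A * (A + B) ^ j` has
to be compared with `B * (A + B) ^ j`. Their coefficients at `A ^ (i + 1) * B ^ (j - i)` are
`j.choose i` and `j.choose (i + 1)`, with ratio `(i + 1) / (j - i)`. Either this is at most `1 + 1 /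
K`, or `i` is atypically large.

Large `i` is paid for by a Chernoff tilt (`Commute.mul_add_pow_apply_le`): replacing `A`, `B` by `y
^ K • A`, `y⁻¹ ^ (K + 1) • B` does not decrease those terms, up to one factor `y ^ K`. For `y`
slightly above 1 the two weights sum to less than 2, so the tilted operator is strictly
substochastic. By the exponential moments its potential decays exponentially (`exists_tsum_pow_le`).
Along the given sequence Green's function does not, so the error is negligible. Letting `K` grow and
exchanging `w` and `w'` gives the limit. -/

/-! ### Positive linear operators and kernels. -/

section Operators

variable {S : Type*}

theorem Module.End.mono_ennreal (T : Module.End ℝ≥0∞ (S → ℝ≥0∞)) {f g : S → ℝ≥0∞} (h : f ≤ g) :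
    T f ≤ T g := by
  rw [← add_tsub_cancel_of_le h, map_add]
  exact le_self_add

theorem Module.End.pow_le_of_le_smul (T : Module.End ℝ≥0∞ (S → ℝ≥0∞)) {f : S → ℝ≥0∞} {c : ℝ≥0∞}
    (h : T f ≤ c • f) (n : ℕ) : (T ^ n) f ≤ c ^ n • f := by
  induction n with
  | zero => simp
  | succ n ih =>
    rw [pow_succ', Module.End.mul_apply]
    calc T ((T ^ n) f) ≤ T (c ^ n • f) := T.mono_ennreal ih
      _ = c ^ n • T f := map_smul _ _ _
      _ ≤ c ^ n • c • f := by gcongr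
      _ = c ^ (n + 1) • f := by rw [smul_smul, pow_succ]

/-- The operator `f ↦ (z ↦ ∑ u, k z u * f u)` of a nonnegative kernel `k`. -/
noncomputable def kernelEnd (k : S → S → ℝ≥0∞) : Module.End ℝ≥0∞ (S → ℝ≥0∞) where
  toFun f z := ∑' u, k z u * f u
  map_add' f g := by ext z; simp [mul_add, ENNReal.tsum_add]
  map_smul' c f := by
    ext z
    simp only [Pi.smul_apply, smul_eq_mul, RingHom.id_apply, ← ENNReal.tsum_mul_left]
    exact tsum_congr fun u => by ring

theorem kernelEnd_apply (k : S → S → ℝ≥0∞) (f : S → ℝ≥0∞) (z : S) :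
    kernelEnd k f z = ∑' u, k z u * f u := rfl

theorem kernelEnd_add (k l : S → S → ℝ≥0∞) : kernelEnd (k + l) = kernelEnd k + kernelEnd l := by
  ext f z
  simp [kernelEnd_apply, add_mul, ENNReal.tsum_add]

theorem kernelEnd_single [DecidableEq S] (k : S → S → ℝ≥0∞) (u z : S) :
    kernelEnd k (Pi.single u 1) z = k z u := by
  rw [kernelEnd_apply, tsum_eq_single u]
  · simp
  · intro v hv; simp [hv]

theorem kernelEnd_mul (k l : S → S → ℝ≥0∞) :
    kernelEnd k * kernelEnd l = kernelEnd fun z v => ∑' u, k z u * l u v := by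
  ext f z
  simp only [Module.End.mul_apply, kernelEnd_apply, ← ENNReal.tsum_mul_left,
    ← ENNReal.tsum_mul_right]
  rw [ENNReal.tsum_comm]
  simp [mul_assoc]

end Operators

/-! ### Binomial comparison of two commuting operators. -/

section Binomial

variable {S : Type*}

theorem Nat.choose_le_choose_succ_add {K : ℕ} (hK : 0 < K) {y : ℝ≥0∞} (hy : 1 ≤ y) (hy' : y ≠ ∞)
    (i j : ℕ) :
    (j.choose i : ℝ≥0∞) ≤ (1 + (K : ℝ≥0∞)⁻¹) * j.choose (i + 1) +
      (y ^ K) * (j.choose i * (y ^ K) ^ i * (y⁻¹ ^ (K + 1)) ^ (j - i)) := by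
  rcases le_total ((K + 1) * (j - i)) (K * (i + 1)) with h | h
  · refine le_add_of_nonneg_of_le (_root_.zero_le) ?_
    -- The case assumption says exactly that the exponent of `y` in this product is nonnegative.
    have h1 : 1 ≤ (y ^ K) ^ (i + 1) * (y⁻¹ ^ (K + 1)) ^ (j - i) := by
      rw [← pow_mul, ← pow_mul, ← ENNReal.inv_pow, ← div_eq_mul_inv]
      rw [ENNReal.le_div_iff_mul_le (by left; positivity) (by left; finiteness), one_mul]
      exact pow_le_pow_right₀ hy h
    calc (j.choose i : ℝ≥0∞) = j.choose i * 1 := by ring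
      _ ≤ j.choose i * ((y ^ K) ^ (i + 1) * (y⁻¹ ^ (K + 1)) ^ (j - i)) := by gcongr
      _ = _ := by ring
  · refine le_add_of_le_of_nonneg ?_ (_root_.zero_le)
    have h2 := Nat.choose_succ_right_eq j i
    have h3 : K * j.choose i ≤ (K + 1) * j.choose (i + 1) := by
      have hpos : 0 < i + 1 := by omega
      refine Nat.le_of_mul_le_mul_left (c := i + 1) ?_ hpos
      calc (i + 1) * (K * j.choose i) = (K * (i + 1)) * j.choose i := by ring
        _ ≤ ((K + 1) * (j - i)) * j.choose i := by gcongr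
        _ = (K + 1) * (j.choose i * (j - i)) := by ring
        _ = (i + 1) * ((K + 1) * j.choose (i + 1)) := by rw [← h2]; ring
    have hK0 : (K : ℝ≥0∞) ≠ 0 := by exact_mod_cast hK.ne'
    have hKt : (K : ℝ≥0∞) ≠ ∞ := by finiteness
    have h4 : (K : ℝ≥0∞) * j.choose i ≤ (K + 1) * j.choose (i + 1) := by exact_mod_cast h3
    calc (j.choose i : ℝ≥0∞) = (K : ℝ≥0∞)⁻¹ * (K * j.choose i) := by
          rw [← mul_assoc, ENNReal.inv_mul_cancel hK0 hKt, one_mul]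
      _ ≤ (K : ℝ≥0∞)⁻¹ * ((K + 1) * j.choose (i + 1)) := by gcongr
      _ = _ := by rw [← mul_assoc, mul_add, ENNReal.inv_mul_cancel hK0 hKt, mul_one]

theorem Commute.mul_add_pow_apply_le {A B : Module.End ℝ≥0∞ (S → ℝ≥0∞)} (hAB : Commute A B)
    {K : ℕ} (hK : 0 < K) {y : ℝ≥0∞} (hy : 1 ≤ y) (hy' : y ≠ ∞) (j : ℕ) (f : S → ℝ≥0∞) :
    (A * (A + B) ^ j) f ≤ (1 + (K : ℝ≥0∞)⁻¹) • (B * (A + B) ^ j) f +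
      y ^ K • (A * ((y ^ K) • A + (y⁻¹ ^ (K + 1)) • B) ^ j) f := by
  have e1 : (A * (A + B) ^ j) f =
      ∑ i ∈ Finset.range (j + 1), (j.choose i : ℝ≥0∞) • (A ^ (i + 1) * B ^ (j - i)) f := by
    rw [hAB.add_pow, Finset.mul_sum, LinearMap.sum_apply]
    refine Finset.sum_congr rfl fun i _ => ?_
    rw [← mul_assoc, ← mul_assoc, ← pow_succ', ← nsmul_eq_mul', LinearMap.smul_apply,
      Nat.cast_smul_eq_nsmul]
  have e2 : (A * ((y ^ K) • A + (y⁻¹ ^ (K + 1)) • B) ^ j) f =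
      ∑ i ∈ Finset.range (j + 1), (j.choose i * (y ^ K) ^ i * (y⁻¹ ^ (K + 1)) ^ (j - i)) •
        (A ^ (i + 1) * B ^ (j - i)) f := by
    rw [((hAB.smul_left _).smul_right _).add_pow, Finset.mul_sum, LinearMap.sum_apply]
    refine Finset.sum_congr rfl fun i _ => ?_
    rw [← mul_assoc, ← nsmul_eq_mul', LinearMap.smul_apply, ← Nat.cast_smul_eq_nsmul ℝ≥0∞,
      smul_pow, smul_pow, smul_mul_smul_comm, mul_smul_comm, ← mul_assoc, ← pow_succ',
      LinearMap.smul_apply, smul_smul, mul_assoc]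
  -- After reindexing, the left side lacks only the `B ^ (j + 1)` term; its own term at `i = j`
  -- vanishes.
  have e3 : ∑ i ∈ Finset.range (j + 1), (j.choose (i + 1) : ℝ≥0∞) •
      (A ^ (i + 1) * B ^ (j - i)) f ≤ (B * (A + B) ^ j) f := by
    have : (B * (A + B) ^ j) f =
        ∑ i ∈ Finset.range (j + 1), (j.choose i : ℝ≥0∞) • (A ^ i * B ^ (j + 1 - i)) f := by
      rw [hAB.add_pow, Finset.mul_sum, LinearMap.sum_apply]
      refine Finset.sum_congr rfl fun i hi => ?_
      rw [← mul_assoc, ← mul_assoc, ← (hAB.pow_left i).eq, mul_assoc (A ^ i), ← pow_succ',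
        ← nsmul_eq_mul', LinearMap.smul_apply, Nat.cast_smul_eq_nsmul,
        Nat.succ_sub (Finset.mem_range_succ_iff.1 hi)]
    rw [this, Finset.sum_range_succ, Finset.sum_range_succ']
    simp
  rw [e1, e2]
  refine le_trans ?_ (add_le_add_left (smul_le_smul_of_nonneg_left e3 (zero_le)) _)
  rw [Finset.smul_sum, Finset.smul_sum, ← Finset.sum_add_distrib]
  refine Finset.sum_le_sum fun i _ => ?_
  rw [smul_smul, smul_smul, ← add_smul]
  exact smul_le_smul_of_nonneg_right (Nat.choose_le_choose_succ_add hK hy hy' i j) (zero_le)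

/-- Since `R` commutes with both shifts, expanding in powers of `R` reduces this to the case `R = 0`
for each `j`; the tilt leaves `R` untouched. -/
theorem Commute.mul_smul_add_add_pow_apply_le {A B R : Module.End ℝ≥0∞ (S → ℝ≥0∞)}
    (hAB : Commute A B) (hAR : Commute A R) (hBR : Commute B R) (δ : ℝ≥0∞)
    {K : ℕ} (hK : 0 < K) {y : ℝ≥0∞} (hy : 1 ≤ y) (hy' : y ≠ ∞) (n : ℕ) (f : S → ℝ≥0∞) :
    (A * (δ • (A + B) + R) ^ n) f ≤
      (1 + (K : ℝ≥0∞)⁻¹) • (B * (δ • (A + B) + R) ^ n) f +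
      y ^ K • (A * (δ • ((y ^ K) • A + (y⁻¹ ^ (K + 1)) • B) + R) ^ n) f := by
  have key : ∀ X Y : Module.End ℝ≥0∞ (S → ℝ≥0∞), Commute Y R → (X * (δ • Y + R) ^ n) f =
      ∑ j ∈ Finset.range (n + 1), (n.choose j * δ ^ j) • (X * Y ^ j) ((R ^ (n - j)) f) := by
    intro X Y hY
    rw [(hY.smul_left δ).add_pow, Finset.mul_sum, LinearMap.sum_apply]
    refine Finset.sum_congr rfl fun j _ => ?_
    rw [← mul_assoc, ← nsmul_eq_mul', LinearMap.smul_apply, ← Nat.cast_smul_eq_nsmul ℝ≥0∞,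
      smul_pow, smul_mul_assoc, mul_smul_comm, LinearMap.smul_apply, smul_smul, ← mul_assoc]
    rfl
  rw [key A _ (hAR.add_left hBR), key B _ (hAR.add_left hBR),
    key A _ ((hAR.smul_left _).add_left (hBR.smul_left _)), Finset.smul_sum, Finset.smul_sum,
    ← Finset.sum_add_distrib]
  refine Finset.sum_le_sum fun j _ => ?_
  rw [smul_comm _ (_ * _), smul_comm _ (_ * _), ← smul_add]
  exact smul_le_smul_of_nonneg_left (hAB.mul_add_pow_apply_le hK hy hy' j _) (zero_le)

/-- At `y = 1` the sum equals 2 and has derivative `K - (K + 1) = -1`. -/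
theorem exists_one_lt_pow_add_inv_pow_succ_lt_two (K : ℕ) :
    ∃ y : ℝ≥0∞, 1 ≤ y ∧ y ≠ ∞ ∧ y ^ K + y⁻¹ ^ (K + 1) < 2 := by
  have hd : HasDerivAt (fun x : ℝ => x ^ K + x⁻¹ ^ (K + 1)) (-1) 1 := by
    have h1 := hasDerivAt_pow K (1 : ℝ)
    have h2 := ((hasDerivAt_inv (one_ne_zero (α := ℝ))).fun_pow (K + 1))
    refine (h1.fun_add h2).congr_deriv ?_
    simp
  have h := (hasDerivAt_iff_tendsto_slope.1 hd).mono_left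
    (nhdsWithin_mono (1 : ℝ) (fun x (hx : x ∈ Set.Ioi 1) => ne_of_gt hx))
  obtain ⟨x, hx, hx1⟩ := ((h.eventually (gt_mem_nhds (show (-1 : ℝ) < 0 by norm_num))).and
    self_mem_nhdsWithin).exists
  have hx1 : 1 < x := hx1
  have hx0 : 0 < x := by linarith
  have hlt : x ^ K + x⁻¹ ^ (K + 1) < 2 := by
    rw [slope_def_field, div_neg_iff] at hx
    rcases hx with hx | hx
    · linarith [hx.2]
    · have := hx.1
      norm_num at this ⊢
      linarith
  refine ⟨ENNReal.ofReal x, by simpa using hx1.le, ENNReal.ofReal_ne_top, ?_⟩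
  rw [← ENNReal.ofReal_inv_of_pos hx0, ← ENNReal.ofReal_pow hx0.le,
    ← ENNReal.ofReal_pow (by positivity), ← ENNReal.ofReal_add (by positivity) (by positivity)]
  simpa using (ENNReal.ofReal_lt_ofReal_iff (by norm_num)).2 hlt

end Binomial

/-! ### Shifts and exponential weights on the state space. -/

theorem EuclideanSpace.exists_norm_le_card_mul_abs {ι : Type*} [Fintype ι] [Nonempty ι]
    (x : EuclideanSpace ℝ ι) : ∃ i, ‖x‖ ≤ Fintype.card ι * |x i| := by
  obtain ⟨i, hi⟩ := Finite.exists_max fun i => |x i|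
  refine ⟨i, ?_⟩
  have h : ‖x‖ ≤ ∑ j, |x j| := by
    rw [EuclideanSpace.norm_eq]
    refine Real.sqrt_le_iff.2 ⟨Finset.sum_nonneg fun _ _ => abs_nonneg _, ?_⟩
    exact Finset.sum_sq_le_sq_sum_of_nonneg fun _ _ => abs_nonneg _
  refine h.trans ((Finset.sum_le_card_nsmul _ _ _ fun j _ => hi j).trans ?_)
  simp

theorem Real.exp_mul_le_one_add {s : ℝ} (h0 : 0 ≤ s) (h1 : s ≤ 1) (t : ℝ) :
    Real.exp (s * t) ≤ 1 + s * Real.exp t := by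
  have := convexOn_exp.2 (Set.mem_univ t) (Set.mem_univ 0) h0 (sub_nonneg.2 h1) (by ring)
  simp only [smul_eq_mul, mul_zero, add_zero, Real.exp_zero, mul_one] at this
  linarith

namespace MAState

variable {d k : ℕ} {E : Set (Fin k → ℤ)}

theorem shift_injective (w : Fin d → ℤ) :
    Function.Injective fun z : MAState d k E => z.shift w := by
  rintro ⟨x, y⟩ ⟨x', y'⟩ h
  simpa [shift] using h

theorem shift_right_injective (z : MAState d k E) :
    Function.Injective fun w : Fin d → ℤ => z.shift w := by
  intro w w' h
  simpa [shift] using h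

theorem shift_shift_comm (z : MAState d k E) (w w' : Fin d → ℤ) :
    (z.shift w).shift w' = (z.shift w').shift w := by
  simp [shift, add_right_comm]

/-- The permutation `z ↦ z + w` of the state space. -/
def shiftEquiv (w : Fin d → ℤ) : MAState d k E ≃ MAState d k E :=
  (Equiv.addRight w).prodCongr (Equiv.refl _)

theorem shiftEquiv_apply (w : Fin d → ℤ) (z : MAState d k E) : shiftEquiv w z = z.shift w := rfl

/-- The operator `f ↦ f (· + w)`. -/
noncomputable def shiftEnd (w : Fin d → ℤ) : Module.End ℝ≥0∞ (MAState d k E → ℝ≥0∞) :=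
  LinearMap.funLeft ℝ≥0∞ ℝ≥0∞ fun z => z.shift w

theorem shiftEnd_apply (w : Fin d → ℤ) (f : MAState d k E → ℝ≥0∞) (z : MAState d k E) :
    shiftEnd w f z = f (z.shift w) := rfl

theorem commute_shiftEnd (w w' : Fin d → ℤ) :
    Commute (shiftEnd w : Module.End ℝ≥0∞ (MAState d k E → ℝ≥0∞)) (shiftEnd w') := by
  ext f z
  simp [shiftEnd_apply, shift_shift_comm]

theorem commute_shiftEnd_kernelEnd {r : MAState d k E → MAState d k E → ℝ≥0∞} {w : Fin d → ℤ}
    (h : ∀ z u, r (z.shift w) (u.shift w) = r z u) : Commute (shiftEnd w) (kernelEnd r) := by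
  ext f z
  rw [Module.End.mul_apply, Module.End.mul_apply, shiftEnd_apply, kernelEnd_apply,
    kernelEnd_apply, ← (shiftEquiv w).tsum_eq]
  simp [shiftEnd_apply, shiftEquiv_apply, h]

theorem kernelEnd_ite_shift [DecidableEq (MAState d k E)] (δ : ℝ≥0∞) (w : Fin d → ℤ) :
    kernelEnd (fun z u : MAState d k E => if u = z.shift w then δ else 0) = δ • shiftEnd w := by
  ext f z
  rw [kernelEnd_apply, tsum_eq_single (z.shift w) fun u hu => by simp [hu]]
  simp [shiftEnd_apply]

/-- The exponential function `z ↦ exp (a · z)`. -/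
noncomputable def expWeight (a : EuclideanSpace ℝ (Fin d ⊕ Fin k)) (z : MAState d k E) : ℝ≥0∞ :=
  ENNReal.ofReal (Real.exp (inner ℝ a z.toEuclidean))

theorem expWeight_le (a : EuclideanSpace ℝ (Fin d ⊕ Fin k)) (z : MAState d k E) :
    expWeight a z ≤ ENNReal.ofReal (Real.exp (‖a‖ * ‖z.toEuclidean‖)) := by
  unfold expWeight
  gcongr
  exact real_inner_le_norm _ _

theorem expWeight_smul_le (a : EuclideanSpace ℝ (Fin d ⊕ Fin k)) {s : ℝ} (h0 : 0 ≤ s) (h1 : s ≤ 1)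
    (z : MAState d k E) :
    (expWeight (s • a) : MAState d k E → ℝ≥0∞) ≤
      expWeight (s • a) z • (1 + (ENNReal.ofReal s * expWeight (-a) z) • expWeight a) := by
  intro u
  simp only [expWeight, Pi.smul_apply, Pi.add_apply, Pi.one_apply, smul_eq_mul]
  rw [← ENNReal.ofReal_mul h0, ← ENNReal.ofReal_mul (by positivity), ← ENNReal.ofReal_one,
    ← ENNReal.ofReal_add zero_le_one (by positivity), ← ENNReal.ofReal_mul (by positivity)]
  refine ENNReal.ofReal_le_ofReal ?_
  have h := Real.exp_mul_le_one_add h0 h1 (inner ℝ a u.toEuclidean - inner ℝ a z.toEuclidean)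
  rw [inner_smul_left, inner_smul_left, inner_neg_left, mul_assoc s, ← Real.exp_add]
  calc Real.exp (s * inner ℝ a u.toEuclidean) = Real.exp (s * inner ℝ a z.toEuclidean) *
        Real.exp (s * (inner ℝ a u.toEuclidean - inner ℝ a z.toEuclidean)) := by
        rw [← Real.exp_add]; ring_nf
    _ ≤ _ := by
      refine mul_le_mul_of_nonneg_left (h.trans_eq ?_) (by positivity)
      ring_nf

theorem expWeight_neg_mul (a : EuclideanSpace ℝ (Fin d ⊕ Fin k)) (z : MAState d k E) :
    expWeight (-a) z * expWeight a z = 1 := by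
  simp [expWeight, ← ENNReal.ofReal_mul (Real.exp_pos _).le, ← Real.exp_add]

theorem single_le_expWeight [DecidableEq (MAState d k E)] (a : EuclideanSpace ℝ (Fin d ⊕ Fin k))
    (v : MAState d k E) : Pi.single v 1 ≤ expWeight (-a) v • expWeight a := by
  intro u
  by_cases h : u = v
  · subst h; simp [expWeight_neg_mul]
  · simp [h]

/-- Convexity of `exp` makes the mass bound `θ` survive a small exponential weight, at a cost linear
in `s`. Thus `θ < 1` still gives a factor below 1 for small `s`. -/
theorem apply_expWeight_smul_le (T : Module.End ℝ≥0∞ (MAState d k E → ℝ≥0∞))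
    (a : EuclideanSpace ℝ (Fin d ⊕ Fin k)) {s : ℝ} (h0 : 0 ≤ s) (h1 : s ≤ 1) {θ L : ℝ≥0∞}
    (hθ : T 1 ≤ θ • 1) (hL : T (expWeight a) ≤ L • expWeight a) :
    T (expWeight (s • a)) ≤ (θ + ENNReal.ofReal s * L) • expWeight (s • a) := by
  intro z
  have h := T.mono_ennreal (expWeight_smul_le a h0 h1 z) z
  refine h.trans ?_
  simp only [map_smul, map_add, Pi.smul_apply, Pi.add_apply, smul_eq_mul]
  rw [mul_comm (θ + _)]
  gcongr _ * (?_ + ?_)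
  · simpa using hθ z
  · calc ENNReal.ofReal s * expWeight (-a) z * T (expWeight a) z
        ≤ ENNReal.ofReal s * expWeight (-a) z * (L * expWeight a z) := by gcongr; exact hL z
      _ = ENNReal.ofReal s * L * (expWeight (-a) z * expWeight a z) := by ring
      _ = ENNReal.ofReal s * L := by rw [expWeight_neg_mul, mul_one]

end MAState

/-! ### The transition operator and exponential decay of potentials. -/

namespace MarkovAdditiveProcess

open MAState

variable {d k : ℕ} {E : Set (Fin k → ℤ)} (Z : MarkovAdditiveProcess d k E)

/-- The transition operator `f ↦ (z ↦ 𝔼_z (f (Z(1))))`. -/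
noncomputable def transEnd : Module.End ℝ≥0∞ (MAState d k E → ℝ≥0∞) := kernelEnd Z.prob

theorem transEnd_pow (n : ℕ) : Z.transEnd ^ n = kernelEnd (Z.stepProb n) := by
  induction n with
  | zero =>
    ext f z
    rw [kernelEnd_apply, tsum_eq_single z]
    · simp [stepProb]
    · intro u hu; simp [stepProb, hu.symm]
  | succ n ih =>
    rw [pow_succ', ih, transEnd, kernelEnd_mul]
    rfl

theorem transEnd_one_le : Z.transEnd 1 ≤ (1 : ℝ≥0∞) • 1 := by
  intro z
  simpa [transEnd, kernelEnd_apply] using Z.sum_prob_le_one z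

theorem prob_shift (w : Fin d → ℤ) (z u : MAState d k E) :
    Z.prob (z.shift w) (u.shift w) = Z.prob z u := by
  obtain ⟨x, y⟩ := z
  obtain ⟨x', y'⟩ := u
  rw [MAState.shift, MAState.shift, Z.prob_additive, Z.prob_additive x]
  simp

theorem stepProb_shift (n : ℕ) (w : Fin d → ℤ) (z u : MAState d k E) :
    Z.stepProb n (z.shift w) (u.shift w) = Z.stepProb n z u := by
  induction n generalizing z u with
  | zero => simp [stepProb, (shift_injective w).eq_iff]
  | succ n ih =>
    simp only [stepProb]
    rw [← (shiftEquiv w).tsum_eq]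
    simp [shiftEquiv_apply, prob_shift, ih]

theorem green_eq_tsum_pow [DecidableEq (MAState d k E)] (z v : MAState d k E) :
    Z.green z v = ∑' n, (Z.transEnd ^ n) (Pi.single v 1) z := by
  simp [green, transEnd_pow, kernelEnd_single]

/-- Division of the time by `m` with remainder `r`. -/
theorem green_eq_tsum_pow_mul [DecidableEq (MAState d k E)] {m : ℕ} (hm : 0 < m)
    (z v : MAState d k E) :
    Z.green z v = ∑' n, ((Z.transEnd ^ m) ^ n)
      ((∑ r ∈ Finset.range m, Z.transEnd ^ r) (Pi.single v 1)) z := by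
  have : NeZero m := ⟨hm.ne'⟩
  rw [green_eq_tsum_pow, ← (Nat.divModEquiv m).symm.tsum_eq, ENNReal.tsum_prod']
  refine tsum_congr fun n => ?_
  rw [LinearMap.sum_apply, map_sum, Finset.sum_apply, Finset.sum_range, tsum_fintype]
  refine Finset.sum_congr rfl fun r _ => ?_
  rw [← Module.End.mul_apply, ← pow_mul, ← pow_add]
  simp [Nat.divModEquiv, mul_comm, add_comm]

theorem transEnd_expWeight_le (a : EuclideanSpace ℝ (Fin d ⊕ Fin k)) :
    Z.transEnd (expWeight a) ≤ Z.jumpTransform a • expWeight a := by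
  intro z
  have h := le_iSup (fun z : MAState d k E => ∑' z' : MAState d k E,
    Z.prob z z' * ENNReal.ofReal (Real.exp (inner ℝ a (z'.toEuclidean - z.toEuclidean)))) z
  refine le_trans (le_of_eq ?_) (mul_le_mul_left h (expWeight a z))
  rw [transEnd, kernelEnd_apply, ← ENNReal.tsum_mul_right]
  refine tsum_congr fun u => ?_
  rw [mul_assoc, expWeight, expWeight, ← ENNReal.ofReal_mul (Real.exp_pos _).le, ← Real.exp_add,
    inner_sub_right, sub_add_cancel]

/-- Finitely many signed coordinate directions suffice later, so a single finite constant serves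
them all. -/
theorem UniformExpMoments.exists_coord_bound {Z : MarkovAdditiveProcess d k E}
    (h : Z.UniformExpMoments) : ∃ ε : ℝ, 0 < ε ∧ ∃ Φ : ℝ≥0∞, Φ ≠ ∞ ∧
      ∀ i, ∀ σ : SignType, Z.jumpTransform (EuclideanSpace.single i (σ * ε)) ≤ Φ := by
  obtain ⟨r, hr, hball⟩ := Metric.eventually_nhds_iff.1 h
  refine ⟨r / 2, by positivity, ∑ p : (Fin d ⊕ Fin k) × SignType,
    Z.jumpTransform (EuclideanSpace.single p.1 (p.2 * (r / 2))), ?_, ?_⟩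
  · refine (ENNReal.sum_lt_top.2 fun p _ => hball ?_).ne
    rw [dist_zero_right, PiLp.norm_single, Real.norm_eq_abs, abs_mul,
      abs_of_pos (half_pos hr)]
    rcases p.2 with _ | _ | _ <;> simp <;> linarith
  · intro i σ
    generalize hg : (fun p : (Fin d ⊕ Fin k) × SignType =>
      Z.jumpTransform (EuclideanSpace.single p.1 (p.2 * (r / 2)))) = g
    rw [show Z.jumpTransform (EuclideanSpace.single i (σ * (r / 2))) = g (i, σ) by rw [← hg]]
    exact Finset.single_le_sum_of_canonicallyOrdered (Finset.mem_univ (i, σ))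

/-- A strictly substochastic operator that is dominated by a power of the transition operator has
an exponentially decaying potential. -/
theorem UniformExpMoments.exists_tsum_pow_le [DecidableEq (MAState d k E)]
    [Nonempty (Fin d ⊕ Fin k)] {Z : MarkovAdditiveProcess d k E} (hZ : Z.UniformExpMoments)
    {m : ℕ} {Q : Module.End ℝ≥0∞ (MAState d k E → ℝ≥0∞)} {θ M : ℝ≥0∞} (hθ : θ < 1)
    (hQ : Q 1 ≤ θ • 1) (hM : M ≠ ∞) (hQM : ∀ f, Q f ≤ M • (Z.transEnd ^ m) f)
    (z : MAState d k E) :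
    ∃ c : ℝ, 0 < c ∧ ∃ C : ℝ≥0∞, C ≠ ∞ ∧ ∀ v : MAState d k E,
      ∑' n, (Q ^ n) ((∑ r ∈ Finset.range m, Z.transEnd ^ r) (Pi.single v 1)) z ≤
        C * ENNReal.ofReal (Real.exp (-c * ‖v.toEuclidean‖)) := by
  obtain ⟨ε, hε, Φ, hΦ, hbound⟩ := hZ.exists_coord_bound
  -- `t` is chosen so small that the linear cost fits into the gap `1 - θ`.
  obtain ⟨t, ht, htL⟩ := ENNReal.exists_nnreal_pos_mul_lt (a := M * Φ ^ m) (b := 1 - θ)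
    (by finiteness) (tsub_pos_of_lt hθ).ne'
  set s : ℝ := min t 1 with hs
  have hs0 : 0 < s := by positivity
  have hs1 : s ≤ 1 := min_le_right _ _
  set ψ := θ + ENNReal.ofReal s * (M * Φ ^ m) with hψ
  have hψ1 : ψ < 1 := by
    refine lt_of_le_of_lt ?_ (lt_tsub_iff_left.1 htL)
    rw [hψ]
    gcongr
    exact (ENNReal.ofReal_le_ofReal (min_le_left _ _)).trans (by simp)
  set D := ∑ r ∈ Finset.range m, (1 + ENNReal.ofReal s * Φ) ^ r with hD
  set N : ℝ := (Fintype.card (Fin d ⊕ Fin k) : ℝ) with hN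
  have hN0 : 0 < N := by rw [hN]; exact_mod_cast Fintype.card_pos
  refine ⟨s * ε / N, by positivity,
    (1 - ψ)⁻¹ * D * ENNReal.ofReal (Real.exp (s * ε * ‖z.toEuclidean‖)), ?_, fun v => ?_⟩
  · have h1 : (1 - ψ)⁻¹ ≠ ∞ := ENNReal.inv_ne_top.2 (tsub_pos_of_lt hψ1).ne'
    have h2 : D ≠ ∞ := ENNReal.sum_ne_top.2 fun r _ => by finiteness
    finiteness
  obtain ⟨i, hi⟩ := EuclideanSpace.exists_norm_le_card_mul_abs v.toEuclidean
  -- The direction depends on `v`: the signed axis of its largest coordinate, so that `a · v ≥ ε ‖v‖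
  -- / N`. The constants above do not depend on it.
  set a : EuclideanSpace ℝ (Fin d ⊕ Fin k) :=
    EuclideanSpace.single i ((SignType.sign (v.toEuclidean i) : SignType) * ε) with ha
  have hPa : Z.transEnd (expWeight a) ≤ Φ • expWeight a :=
    (Z.transEnd_expWeight_le a).trans
      (smul_le_smul_of_nonneg_right (hbound i _) zero_le)
  have hQa : Q (expWeight a) ≤ (M * Φ ^ m) • expWeight a := by
    refine (hQM _).trans ?_
    rw [mul_smul]
    exact smul_le_smul_of_nonneg_left (Z.transEnd.pow_le_of_le_smul hPa m) zero_le
  have hQs := Q.pow_le_of_le_smul (apply_expWeight_smul_le Q a hs0.le hs1 hQ hQa)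
  have hPs := Z.transEnd.pow_le_of_le_smul
    (apply_expWeight_smul_le Z.transEnd a hs0.le hs1 Z.transEnd_one_le hPa)
  have hH : (∑ r ∈ Finset.range m, Z.transEnd ^ r) (expWeight (s • a)) ≤
      D • expWeight (s • a) := by
    rw [LinearMap.sum_apply, hD, Finset.sum_smul]
    exact Finset.sum_le_sum fun r _ => hPs r
  have hv : expWeight (-(s • a)) v ≤
      ENNReal.ofReal (Real.exp (-(s * ε / N) * ‖v.toEuclidean‖)) := by
    unfold expWeight
    refine ENNReal.ofReal_le_ofReal (Real.exp_le_exp.2 ?_)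
    have : inner ℝ a v.toEuclidean = ε * |v.toEuclidean i| := by
      rw [ha, EuclideanSpace.inner_single_left]
      simp only [conj_trivial]
      rw [mul_right_comm, sign_mul_self, mul_comm]
    rw [inner_neg_left, inner_smul_left, this]
    simp only [conj_trivial, neg_mul, neg_le_neg_iff]
    calc s * ε / N * ‖v.toEuclidean‖ ≤ s * ε / N * (N * |v.toEuclidean i|) := by gcongr
      _ = s * (ε * |v.toEuclidean i|) := by field_simp
  have hz : expWeight (s • a) z ≤ ENNReal.ofReal (Real.exp (s * ε * ‖z.toEuclidean‖)) := by
    refine (expWeight_le _ _).trans (ENNReal.ofReal_le_ofReal (Real.exp_le_exp.2 ?_))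
    gcongr
    rw [norm_smul, ha, PiLp.norm_single, Real.norm_of_nonneg hs0.le, norm_mul,
      Real.norm_of_nonneg hε.le]
    gcongr
    refine mul_le_of_le_one_left hε.le ?_
    rcases SignType.sign (v.toEuclidean i) with _ | _ | _ <;> simp
  calc ∑' n, (Q ^ n) ((∑ r ∈ Finset.range m, Z.transEnd ^ r) (Pi.single v 1)) z
      ≤ ∑' n, ψ ^ n * (expWeight (-(s • a)) v * D * expWeight (s • a) z) := by
        refine ENNReal.tsum_le_tsum fun n => ?_
        have h1 : (∑ r ∈ Finset.range m, Z.transEnd ^ r) (Pi.single v 1) ≤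
            (expWeight (-(s • a)) v * D) • expWeight (s • a) := by
          refine (Module.End.mono_ennreal _ (single_le_expWeight (s • a) v)).trans ?_
          rw [map_smul, mul_smul]
          exact smul_le_smul_of_nonneg_left hH zero_le
        refine (Module.End.mono_ennreal _ h1 z).trans ?_
        rw [map_smul, Pi.smul_apply, smul_eq_mul]
        calc _ ≤ expWeight (-(s • a)) v * D * (ψ ^ n * expWeight (s • a) z) := by
              gcongr; exact hQs n z
          _ = _ := by ring
    _ = (1 - ψ)⁻¹ * (expWeight (-(s • a)) v * D * expWeight (s • a) z) := by
        rw [ENNReal.tsum_mul_right, ENNReal.tsum_geometric]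
    _ ≤ (1 - ψ)⁻¹ * (ENNReal.ofReal (Real.exp (-(s * ε / N) * ‖v.toEuclidean‖)) * D *
          ENNReal.ofReal (Real.exp (s * ε * ‖z.toEuclidean‖))) := by gcongr
    _ = _ := by ring

end MarkovAdditiveProcess

/-! ### Comparison of Green's functions at shifted starting points. -/

namespace MarkovAdditiveProcess

open MAState

variable {d k : ℕ} {E : Set (Fin k → ℤ)} {Z : MarkovAdditiveProcess d k E}

/-- Splitting off the two shifts from the `m`-step transition operator. -/
theorem exists_transEnd_pow_eq [DecidableEq (MAState d k E)] {m : ℕ} {w w' : Fin d → ℤ}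
    (hne : w ≠ w') {δ : ℝ≥0∞}
    (hδ : ∀ u : MAState d k E,
      δ ≤ min (Z.stepProb m u (u.shift w)) (Z.stepProb m u (u.shift w'))) :
    ∃ R : Module.End ℝ≥0∞ (MAState d k E → ℝ≥0∞), Commute (shiftEnd w) R ∧
      Commute (shiftEnd w') R ∧ Z.transEnd ^ m = δ • (shiftEnd w + shiftEnd w') + R := by
  set q : (Fin d → ℤ) → MAState d k E → MAState d k E → ℝ≥0∞ :=
    fun v z u => if u = z.shift v then δ else 0 with hq
  have hqs : ∀ v v' z u, q v (z.shift v') (u.shift v') = q v z u := by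
    intro v v' z u
    simp only [hq, shift_shift_comm z v' v, (shift_injective v').eq_iff]
  set r := Z.stepProb m - (q w + q w') with hr
  have hrs : ∀ v z u, r (z.shift v) (u.shift v) = r z u := by
    intro v z u
    simp only [hr, Pi.sub_apply, Pi.add_apply, hqs, stepProb_shift]
  -- `w ≠ w'` is essential: the two subtracted kernels then charge different targets.
  have hle : q w + q w' ≤ Z.stepProb m := by
    intro z u
    simp only [hq, Pi.add_apply]
    by_cases h : u = z.shift w
    · have h' : u ≠ z.shift w' := fun h' => hne (shift_right_injective z (h.symm.trans h'))
      rw [if_pos h, if_neg h', add_zero, h]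
      exact (hδ z).trans (min_le_left _ _)
    · by_cases h' : u = z.shift w'
      · rw [if_neg h, if_pos h', zero_add, h']
        exact (hδ z).trans (min_le_right _ _)
      · simp [h, h']
  refine ⟨kernelEnd r, commute_shiftEnd_kernelEnd (hrs w), commute_shiftEnd_kernelEnd (hrs w'), ?_⟩
  rw [transEnd_pow, ← add_tsub_cancel_of_le hle, kernelEnd_add, kernelEnd_add,
    kernelEnd_ite_shift, kernelEnd_ite_shift, ← smul_add]

theorem UniformExpMoments.exists_green_shift_le (hZ : Z.UniformExpMoments) {m : ℕ} (hm : 0 < m)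
    {w w' : Fin d → ℤ} (hne : w ≠ w')
    (hpos : 0 < ⨅ u : MAState d k E,
      min (Z.stepProb m u (u.shift w)) (Z.stepProb m u (u.shift w')))
    (z : MAState d k E) {K : ℕ} (hK : 0 < K) :
    ∃ c : ℝ, 0 < c ∧ ∃ C : ℝ≥0∞, C ≠ ∞ ∧ ∀ v : MAState d k E,
      Z.green (z.shift w) v ≤ (1 + (K : ℝ≥0∞)⁻¹) * Z.green (z.shift w') v +
        C * ENNReal.ofReal (Real.exp (-c * ‖v.toEuclidean‖)) := by
  classical
  obtain ⟨i, -⟩ := Function.ne_iff.1 hne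
  have : Nonempty (Fin d ⊕ Fin k) := ⟨Sum.inl i⟩
  set δ := ⨅ u : MAState d k E,
      min (Z.stepProb m u (u.shift w)) (Z.stepProb m u (u.shift w')) with hδ
  obtain ⟨R, hwR, hwR', hP⟩ := exists_transEnd_pow_eq (Z := Z) (m := m) hne (δ := δ)
    (fun u => iInf_le _ u)
  obtain ⟨y, hy1, hyt, hy2⟩ := exists_one_lt_pow_add_inv_pow_succ_lt_two K
  set α := y ^ K with hα
  set β := y⁻¹ ^ (K + 1) with hβ
  have hα1 : 1 ≤ α := one_le_pow₀ hy1
  have hβα : β ≤ α := (pow_le_one₀ zero_le (ENNReal.inv_le_one.2 hy1)).trans hα1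
  have hαt : α ≠ ∞ := by finiteness
  set A : Module.End ℝ≥0∞ (MAState d k E → ℝ≥0∞) := shiftEnd w with hA
  set B : Module.End ℝ≥0∞ (MAState d k E → ℝ≥0∞) := shiftEnd w' with hB
  set Q := δ • (α • A + β • B) + R with hQdef
  have hmass : ∀ z, δ * 2 + R 1 z ≤ 1 := by
    intro z
    have h := (Z.transEnd.pow_le_of_le_smul Z.transEnd_one_le m) z
    rw [hP] at h
    simpa [hA, hB, shiftEnd_apply, mul_two] using h
  have hδ2 : δ * 2 ≤ 1 := le_self_add.trans (hmass z)
  have hδt : δ ≠ ∞ := by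
    rintro h
    rw [h] at hδ2
    simp at hδ2
  have hQ1 : Q 1 ≤ (δ * (α + β) + (1 - δ * 2)) • 1 := by
    intro z
    have hR : R 1 z ≤ 1 - δ * 2 :=
      ENNReal.le_sub_of_add_le_left (by finiteness) (hmass z)
    simpa [hQdef, hA, hB, shiftEnd_apply, mul_add] using add_le_add_right hR (δ * α + δ * β)
  have hθ : δ * (α + β) + (1 - δ * 2) < 1 :=
    calc δ * (α + β) + (1 - δ * 2) < δ * 2 + (1 - δ * 2) :=
          ENNReal.add_lt_add_right (by finiteness) (ENNReal.mul_lt_mul_right hpos.ne' hδt hy2)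
      _ = 1 := add_tsub_cancel_of_le hδ2
  -- This only transfers exponential moments from `P ^ m` to `Q`; the contraction comes from `hθ`.
  have hQP : ∀ f, Q f ≤ α • (Z.transEnd ^ m) f := by
    intro f z
    rw [hP]
    simp only [hQdef, LinearMap.add_apply, LinearMap.smul_apply, Pi.add_apply, Pi.smul_apply,
      smul_eq_mul]
    calc δ * (α * A f z + β * B f z) + R f z ≤ δ * (α * A f z + α * B f z) + α * R f z := by
          gcongr
          exact le_mul_of_one_le_left zero_le hα1
      _ = α * (δ * (A f z + B f z) + R f z) := by ring
  obtain ⟨c, hc, C, hC, hbound⟩ := hZ.exists_tsum_pow_le hθ hQ1 hαt hQP (z.shift w)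
  refine ⟨c, hc, α * C, by finiteness, fun v => ?_⟩
  rw [Z.green_eq_tsum_pow_mul hm, Z.green_eq_tsum_pow_mul hm]
  set f := (∑ r ∈ Finset.range m, Z.transEnd ^ r) (Pi.single v 1)
  calc ∑' n, ((Z.transEnd ^ m) ^ n) f (z.shift w)
      ≤ ∑' n, ((1 + (K : ℝ≥0∞)⁻¹) * ((Z.transEnd ^ m) ^ n) f (z.shift w') +
          α * (Q ^ n) f (z.shift w)) := by
        refine ENNReal.tsum_le_tsum fun n => ?_
        rw [hP]
        exact (commute_shiftEnd w w').mul_smul_add_add_pow_apply_le hwR hwR' δ hK hy1 hyt n f z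
    _ = (1 + (K : ℝ≥0∞)⁻¹) * ∑' n, ((Z.transEnd ^ m) ^ n) f (z.shift w') +
          α * ∑' n, (Q ^ n) f (z.shift w) := by
        rw [ENNReal.tsum_add, ENNReal.tsum_mul_left, ENNReal.tsum_mul_left]
    _ ≤ _ := by
        rw [mul_assoc]
        gcongr
        exact hbound v

theorem stepProb_mul_green_le (n : ℕ) (z u v : MAState d k E) :
    Z.stepProb n z u * Z.green u v ≤ Z.green z v := by
  classical
  rw [green_eq_tsum_pow, green_eq_tsum_pow, ← ENNReal.tsum_mul_left]
  calc ∑' l, Z.stepProb n z u * (Z.transEnd ^ l) (Pi.single v 1) u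
      ≤ ∑' l, (Z.transEnd ^ (l + n)) (Pi.single v 1) z := by
        refine ENNReal.tsum_le_tsum fun l => ?_
        rw [add_comm, pow_add, Module.End.mul_apply, Z.transEnd_pow n, kernelEnd_apply]
        exact ENNReal.le_tsum u
    _ ≤ _ := ENNReal.tsum_comp_le_tsum_of_injective (add_left_injective n)
        fun l => (Z.transEnd ^ l) (Pi.single v 1) z

theorem Irreducible.green_ne_zero (h : Z.Irreducible) (z v : MAState d k E) :
    Z.green z v ≠ 0 := by
  obtain ⟨n, hn⟩ := h z v
  exact (hn.trans_le (ENNReal.le_tsum n)).ne'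

/-- A path from `v` back to `z` bounds a multiple of `G(z, v)` by `G(v, v)`. -/
theorem Irreducible.green_ne_top (h : Z.Irreducible) (ht : Z.Transient) (z v : MAState d k E) :
    Z.green z v ≠ ∞ := by
  obtain ⟨n, hn⟩ := h v z
  intro htop
  have := Z.stepProb_mul_green_le n v z v
  rw [htop, ENNReal.mul_top hn.ne'] at this
  exact (ht v).not_ge this

/-- A Green function that does not decay exponentially along a sequence dominates every
exponential. -/
theorem Irreducible.tendsto_exp_div_green (h : Z.Irreducible) {zs : ℕ → MAState d k E}
    (hzs : Tendsto (fun n => ‖(zs n).toEuclidean‖) atTop atTop) {z₀ : MAState d k E}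
    (hgreen : (0 : EReal) ≤ liminf (fun n =>
        ((1 / ‖(zs n).toEuclidean‖ : ℝ) : EReal) * ENNReal.log (Z.green z₀ (zs n))) atTop)
    (u : MAState d k E) {c : ℝ} (hc : 0 < c) :
    Tendsto (fun n => ENNReal.ofReal (Real.exp (-c * ‖(zs n).toEuclidean‖)) / Z.green u (zs n))
      atTop (𝓝 0) := by
  obtain ⟨N, hN⟩ := h u z₀
  set p := Z.stepProb N u z₀
  -- Half of the rate `c` bounds Green's function from below; the other half tends to zero.
  have hev : ∀ᶠ n in atTop,
      ENNReal.ofReal (Real.exp (-(c / 2) * ‖(zs n).toEuclidean‖)) ≤ Z.green z₀ (zs n) := by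
    have hlt : ((-(c / 2) : ℝ) : EReal) < liminf (fun n =>
        ((1 / ‖(zs n).toEuclidean‖ : ℝ) : EReal) * ENNReal.log (Z.green z₀ (zs n))) atTop := by
      refine lt_of_lt_of_le ?_ hgreen
      exact_mod_cast neg_lt_zero.2 (half_pos hc)
    filter_upwards [eventually_lt_of_lt_liminf hlt, hzs.eventually_gt_atTop 0] with n hn hpos
    rw [← ENNReal.log_le_log_iff, ENNReal.log_ofReal_of_pos (Real.exp_pos _), Real.log_exp]
    have hmul := mul_le_mul_of_nonneg_left hn.le
      (show (0 : EReal) ≤ ((‖(zs n).toEuclidean‖ : ℝ) : EReal) by exact_mod_cast hpos.le)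
    rw [← mul_assoc, ← EReal.coe_mul, ← EReal.coe_mul, mul_one_div_cancel hpos.ne', EReal.coe_one,
      one_mul, mul_comm] at hmul
    exact hmul
  have hlim : Tendsto (fun n => p⁻¹ *
      ENNReal.ofReal (Real.exp (-(c / 2) * ‖(zs n).toEuclidean‖))) atTop (𝓝 0) := by
    have h1 : Tendsto (fun n => Real.exp (-(c / 2) * ‖(zs n).toEuclidean‖)) atTop (𝓝 0) :=
      Real.tendsto_exp_atBot.comp (hzs.const_mul_atTop_of_neg (by linarith))
    have h2 := ENNReal.Tendsto.const_mul (a := p⁻¹) (ENNReal.tendsto_ofReal h1)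
      (Or.inr (ENNReal.inv_ne_top.2 hN.ne'))
    simpa using h2
  refine tendsto_of_tendsto_of_tendsto_of_le_of_le' tendsto_const_nhds hlim
    (Eventually.of_forall fun _ => zero_le) ?_
  filter_upwards [hev] with n hn
  set e := ENNReal.ofReal (Real.exp (-(c / 2) * ‖(zs n).toEuclidean‖)) with he
  have he0 : e ≠ 0 := by simp [he, Real.exp_pos]
  have het : e ≠ ∞ := ENNReal.ofReal_ne_top
  have hee : ENNReal.ofReal (Real.exp (-c * ‖(zs n).toEuclidean‖)) = e * e := by
    rw [he, ← ENNReal.ofReal_mul (Real.exp_pos _).le, ← Real.exp_add]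
    ring_nf
  have hge : p * e ≤ Z.green u (zs n) :=
    (mul_le_mul_right hn p).trans (Z.stepProb_mul_green_le N u z₀ (zs n))
  calc _ ≤ e * e / (p * e) := by rw [hee]; gcongr
    _ = p⁻¹ * e := by
      rw [ENNReal.mul_div_mul_right _ _ he0 het, div_eq_mul_inv, mul_comm]

theorem eventually_green_shift_div_le (htrans : Z.Transient) (hA1 : Z.Irreducible)
    (hA2 : Z.UniformExpMoments) {zs : ℕ → MAState d k E}
    (hzs : Tendsto (fun n => ‖(zs n).toEuclidean‖) atTop atTop) {z₀ : MAState d k E}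
    (hgreen : (0 : EReal) ≤ liminf (fun n =>
        ((1 / ‖(zs n).toEuclidean‖ : ℝ) : EReal) * ENNReal.log (Z.green z₀ (zs n))) atTop)
    (z : MAState d k E) {m : ℕ} (hm : 0 < m) {w w' : Fin d → ℤ} (hne : w ≠ w')
    (hpos : 0 < ⨅ u : MAState d k E,
      min (Z.stepProb m u (u.shift w)) (Z.stepProb m u (u.shift w')))
    {b : ℝ≥0∞} (hb : 1 < b) :
    ∀ᶠ n in atTop, Z.green (z.shift w) (zs n) / Z.green (z.shift w') (zs n) < b := by
  obtain ⟨K, hK⟩ := ENNReal.exists_inv_nat_lt (tsub_pos_of_lt hb).ne'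
  have hKb : 1 + ((K + 1 : ℕ) : ℝ≥0∞)⁻¹ < b := by
    refine lt_of_le_of_lt ?_ (lt_tsub_iff_left.1 hK)
    gcongr
    exact_mod_cast K.le_succ
  obtain ⟨c, hc, C, hC, hle⟩ := hA2.exists_green_shift_le hm hne hpos z K.succ_pos
  have hlim : Tendsto (fun n => 1 + ((K + 1 : ℕ) : ℝ≥0∞)⁻¹ + C *
      (ENNReal.ofReal (Real.exp (-c * ‖(zs n).toEuclidean‖)) / Z.green (z.shift w') (zs n)))
      atTop (𝓝 (1 + ((K + 1 : ℕ) : ℝ≥0∞)⁻¹)) := by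
    have h := (ENNReal.Tendsto.const_mul (a := C)
      (hA1.tendsto_exp_div_green hzs hgreen (z.shift w') hc) (Or.inr hC)).const_add
      (1 + ((K + 1 : ℕ) : ℝ≥0∞)⁻¹)
    simpa only [mul_zero, add_zero] using h
  filter_upwards [hlim.eventually_lt_const hKb] with n hn
  refine lt_of_le_of_lt ?_ hn
  have h0 := hA1.green_ne_zero (z.shift w') (zs n)
  have ht := hA1.green_ne_top htrans (z.shift w') (zs n)
  calc _ ≤ _ := ENNReal.div_le_div_right (hle (zs n)) _
    _ = _ := by rw [ENNReal.add_div, ENNReal.mul_div_cancel_right h0 ht, mul_div_assoc]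

end MarkovAdditiveProcess

theorem proposition3p1 {d k : ℕ} {E : Set (Fin k → ℤ)} (Z : MarkovAdditiveProcess d k E)
    (htrans : Z.Transient) (hA1 : Z.Irreducible) (hA2 : Z.UniformExpMoments)
    (zs : ℕ → MAState d k E)
    (hzs : Tendsto (fun n => ‖(zs n).toEuclidean‖) atTop atTop)
    (hgreen : ∃ z₀ : MAState d k E,
      (0 : EReal) ≤ liminf (fun n =>
        ((1 / ‖(zs n).toEuclidean‖ : ℝ) : EReal) * ENNReal.log (Z.green z₀ (zs n))) atTop)
    (z : MAState d k E) (w w' : Fin d → ℤ)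
    (hww' : ∃ m : ℕ, 0 < m ∧
      0 < ⨅ u : MAState d k E,
        min (Z.stepProb m u (u.shift w)) (Z.stepProb m u (u.shift w'))) :
    Tendsto (fun n => Z.green (z.shift w) (zs n) / Z.green (z.shift w') (zs n))
      atTop (𝓝 1) := by
  obtain ⟨z₀, hz₀⟩ := hgreen
  obtain ⟨m, hm, hpos⟩ := hww'
  have h0 := hA1.green_ne_zero
  have ht := hA1.green_ne_top htrans
  rcases eq_or_ne w w' with rfl | hne
  · simp only [ENNReal.div_self (h0 _ _) (ht _ _)]
    exact tendsto_const_nhds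
  refine tendsto_order.2 ⟨fun b hb => ?_, fun b hb => ?_⟩
  -- The lower bound is the upper bound for the inverse ratio, with `w` and `w'` exchanged.
  · have hpos' : 0 < ⨅ u : MAState d k E,
        min (Z.stepProb m u (u.shift w')) (Z.stepProb m u (u.shift w)) := by
      simpa only [min_comm] using hpos
    filter_upwards [MarkovAdditiveProcess.eventually_green_shift_div_le htrans hA1 hA2 hzs hz₀ z hm
      hne.symm hpos' (ENNReal.one_lt_inv.2 hb)] with n hn
    rwa [← ENNReal.inv_lt_inv, ENNReal.inv_div (Or.inl (ht _ _)) (Or.inl (h0 _ _))]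
  · exact MarkovAdditiveProcess.eventually_green_shift_div_le htrans hA1 hA2 hzs hz₀ z hm hne
      hpos hb
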